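/- Let $(M,\Omega,\mathbb T,\mu)$ be a compact connected toric symplectic manifold of dimension $2n$: $(M,\Omega)$ is a symplectic manifold with an effective Hamiltonian action of the torus $\mathbb T=\mathbb T^n$. Fix a basis $e_1,\dots,e_n$ of the Lie algebra $\mathfrak t\cong\mathbb R^n$ of $\mathbb T$, let $X_j$ be the fundamental vector field of $e_j$, and let $\mu=(\mu_1,\dots,\mu_n)$ be the components of the moment map, which is $\mathbb T$-invariant and normalized by $\Omega(X_j,\cdot)=-d\mu_j$. Let $\Delta=\mu(M)$ be the moment polytope, $\mathring\Delta$ its interior and $\mathring M=\mu^{-1}(\mathring\Delta)$. Let $I_0$ be a toric Kähler structure on $M$, i.e. a $\mathbb T$-invariant integrable complex structure with $\Omega(I_0\cdot,I_0\cdot)=\Omega$ and $\Omega(v,I_0v)>0$ for $v\ne0$. Let $\tau$ be its symplectic potential, i.e. a smooth function on $\mathring\Delta$ with Hessian $\phi_s$ such that on $\mathring M$ the $1$-forms $\vartheta_j:=-\sum_k(\phi_s)_{jk}(\mu)\,d\mu_k$ satisfy $\vartheta_j(X_l)=0$ and $\vartheta_j(I_0X_l)=\delta_{jl}$. The matrix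 function $(\phi_s)^{-1}$ is extended from $\mathring M$ to $M$ by continuity, as a $\mathbb T$-invariant function (such functions are identified with functions on $\Delta=M/\mathbb T$), and $(\phi_s)^{-1/2}$ denotes its nonnegative-definite square root. Let $\mathcal A_n$ be the linear space of antisymmetric real $n\times n$ matrices with the norm $\|F\|=\sqrt{-\operatorname{tr}(F^2)}$, and let $\mathcal A_\tau\subset\mathcal A_n$ be the set of those $F$ for which $$\mathrm I+\tfrac14\big[(\phi_s)^{-1/2}F(\phi_s)^{-1/2}\big]^2$$ is positive definite at every point of $\Delta$, including the boundary points. Then $\mathcal A_\tau$ is a bounded, open, convex subset of $\mathcal A_n$, and it is a cone with vertex $0$ in the sense that $0\in\mathcal A_\tau$ and $tF\in\mathcal A_\tau$ whenever $F\in\mathcal A_\tau$ and $t\in[0,1]$. -/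

import Mathlib

open scoped Manifold ContDiff Topology MatrixOrder Matrix

noncomputable section

namespace ToricKahler

/-! ### Antisymmetric matrices with the norm `√(-tr F²)` -/

/-- The antisymmetric real `n × n` matrices, as a linear subspace of all matrices. -/
def antisymSubmodule (n : ℕ) : Submodule ℝ (Matrix (Fin n) (Fin n) ℝ) where
  carrier := {F | Fᵀ = -F}
  add_mem' := by
    intro a b ha hb
    have ha' : aᵀ = -a := ha
    have hb' : bᵀ = -b := hb
    change (a + b)ᵀ = -(a + b)
    rw [Matrix.transpose_add, ha', hb', neg_add]
  zero_mem' := by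
    change (0 : Matrix (Fin n) (Fin n) ℝ)ᵀ = -0
    simp
  smul_mem' := by
    intro c a ha
    have ha' : aᵀ = -a := ha
    change (c • a)ᵀ = -(c • a)
    rw [Matrix.transpose_smul, ha', smul_neg]

/-- The vector space of antisymmetric real `n × n` matrices.  It is a separate type, so that its
only norm and topology are those of `‖F‖ = √(-tr F²)`. -/
def AntisymMat (n : ℕ) : Type := antisymSubmodule n

namespace AntisymMat

variable {n : ℕ}

instance : AddCommGroup (AntisymMat n) := inferInstanceAs (AddCommGroup (antisymSubmodule n))

instance : Module ℝ (AntisymMat n) := inferInstanceAs (Module ℝ (antisymSubmodule n))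

/-- The underlying matrix. -/
def toMat (F : AntisymMat n) : Matrix (Fin n) (Fin n) ℝ := F.1

theorem toMat_transpose (F : AntisymMat n) : (toMat F)ᵀ = -toMat F := F.2

theorem toMat_add (F G : AntisymMat n) : toMat (F + G) = toMat F + toMat G := rfl

theorem toMat_smul (c : ℝ) (F : AntisymMat n) : toMat (c • F) = c • toMat F := rfl

theorem toMat_injective : Function.Injective (toMat : AntisymMat n → _) :=
  Subtype.coe_injective

instance : Norm (AntisymMat n) := ⟨fun F => √(-(toMat F * toMat F).trace)⟩

theorem norm_def (F : AntisymMat n) : ‖F‖ = √(-(toMat F * toMat F).trace) := rfl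

theorem neg_trace_sq (F : AntisymMat n) :
    -(toMat F * toMat F).trace = ∑ i, ∑ j, toMat F i j ^ 2 := by
  have h : -(toMat F * toMat F) = toMat F * (toMat F)ᵀ := by
    rw [toMat_transpose, mul_neg]
  rw [← Matrix.trace_neg, h]
  simp [Matrix.trace, Matrix.mul_apply, sq]

/-- The entries of the matrix, as a vector of a Euclidean space. -/
def toEuclidean (F : AntisymMat n) : EuclideanSpace ℝ (Fin n × Fin n) :=
  WithLp.toLp 2 fun q => toMat F q.1 q.2

theorem norm_eq_euclidean (F : AntisymMat n) : ‖F‖ = ‖toEuclidean F‖ := by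
  rw [norm_def, neg_trace_sq, EuclideanSpace.norm_eq, Fintype.sum_prod_type]
  simp [toEuclidean]

theorem normedSpaceCore (n : ℕ) : NormedSpace.Core ℝ (AntisymMat n) where
  norm_nonneg F := Real.sqrt_nonneg _
  norm_smul c F := by
    have h : toEuclidean (c • F) = c • toEuclidean F := rfl
    rw [norm_eq_euclidean, norm_eq_euclidean, h, norm_smul]
  norm_triangle F G := by
    have h : toEuclidean (F + G) = toEuclidean F + toEuclidean G := rfl
    rw [norm_eq_euclidean, norm_eq_euclidean, norm_eq_euclidean, h]
    exact norm_add_le _ _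
  norm_eq_zero_iff F := by
    rw [norm_eq_euclidean, norm_eq_zero]
    constructor
    · intro h
      apply toMat_injective
      ext i j
      exact congrArg (fun v : EuclideanSpace ℝ (Fin n × Fin n) => v (i, j)) h
    · rintro rfl
      rfl

instance : NormedAddCommGroup (AntisymMat n) := NormedAddCommGroup.ofCore (normedSpaceCore n)

instance : NormedSpace ℝ (AntisymMat n) := NormedSpace.ofCore (normedSpaceCore n)

end AntisymMat

/-! ### Toric symplectic manifolds -/

/-- The exponential map `ℝⁿ → 𝕋ⁿ`, `(ξ₁, …, ξₙ) ↦ (exp (i ξ₁), …, exp (i ξₙ))`, of the torus. -/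
def torusExp {n : ℕ} (ξ : Fin n → ℝ) : Fin n → Circle := fun j => Circle.exp (ξ j)

section Manifold

variable (n : ℕ) (M : Type*) [TopologicalSpace M] [ChartedSpace (EuclideanSpace ℝ (Fin (2 * n))) M]

variable {n M} in
/-- The derivative `X f` at `p` of a real function in the direction of a tangent vector. -/
def dirDeriv (f : M → ℝ) (p : M) (v : TangentSpace (𝓡 (2 * n)) p) : ℝ :=
  (mfderiv (𝓡 (2 * n)) 𝓘(ℝ, ℝ) f p : TangentSpace (𝓡 (2 * n)) p →L[ℝ] ℝ) v

variable [IsManifold (𝓡 (2 * n)) ∞ M]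

variable {n M} in
/-- Smooth vector fields on `M`. -/
def IsSmoothField (X : ∀ p : M, TangentSpace (𝓡 (2 * n)) p) : Prop :=
  ContMDiff (𝓡 (2 * n)) (𝓡 (2 * n)).tangent ∞
    (fun p => (⟨p, X p⟩ : TangentBundle (𝓡 (2 * n)) M))

variable [MulAction (Fin n → Circle) M]

variable {n M} in
/-- The fundamental vector field of `ξ ∈ 𝔱 = ℝⁿ`: the velocity at `s = 0` of `exp (s ξ) • p`. -/
def fundField (ξ : Fin n → ℝ) (p : M) : TangentSpace (𝓡 (2 * n)) p :=
  (mfderiv 𝓘(ℝ, ℝ) (𝓡 (2 * n)) (fun s : ℝ => torusExp (s • ξ) • p) 0 :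
    ℝ →L[ℝ] EuclideanSpace ℝ (Fin (2 * n))) (1 : ℝ)

variable {n M} in
/-- The differential at `p` of the diffeomorphism of `M` given by `t ∈ 𝕋ⁿ`. -/
def actDeriv (t : Fin n → Circle) (p : M) :
    TangentSpace (𝓡 (2 * n)) p →L[ℝ] TangentSpace (𝓡 (2 * n)) (t • p) :=
  mfderiv (𝓡 (2 * n)) (𝓡 (2 * n)) (fun q : M => t • q) p

/-- The data of a Hamiltonian action of the torus `𝕋ⁿ` on a symplectic manifold of dimension `2n`
(effectiveness of the action is the class `FaithfulSMul`).  Here `e` is a basis of the Lie algebra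
`𝔱 = ℝⁿ`, and the moment map `M → 𝔱*` is given by its components `μ_j = ⟨μ, e_j⟩`. -/
structure ToricSymplectic (e : Module.Basis (Fin n) ℝ (Fin n → ℝ)) where
  /-- The action is smooth (`torusExp` is a smooth covering map of `𝕋ⁿ`). -/
  smooth_action : ContMDiff (𝓘(ℝ, Fin n → ℝ).prod (𝓡 (2 * n))) (𝓡 (2 * n)) ∞
    (fun q : (Fin n → ℝ) × M => torusExp q.1 • q.2)
  /-- The symplectic form. -/
  Ω : ∀ p : M, TangentSpace (𝓡 (2 * n)) p →L[ℝ] TangentSpace (𝓡 (2 * n)) p →L[ℝ] ℝ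
  smooth_Ω : ContMDiff (𝓡 (2 * n)) ((𝓡 (2 * n)).prod
      𝓘(ℝ, EuclideanSpace ℝ (Fin (2 * n)) →L[ℝ] EuclideanSpace ℝ (Fin (2 * n)) →L[ℝ] ℝ)) ∞
    (fun p => Bundle.TotalSpace.mk'
      (EuclideanSpace ℝ (Fin (2 * n)) →L[ℝ] EuclideanSpace ℝ (Fin (2 * n)) →L[ℝ] ℝ)
      (E := fun p : M => TangentSpace (𝓡 (2 * n)) p →L[ℝ] TangentSpace (𝓡 (2 * n)) p →L[ℝ] ℝ)
      p (Ω p))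
  alternating : ∀ (p : M) (v : TangentSpace (𝓡 (2 * n)) p), Ω p v v = 0
  nondegenerate : ∀ (p : M) (v : TangentSpace (𝓡 (2 * n)) p), (∀ w, Ω p v w = 0) → v = 0
  /-- `dΩ = 0`, through the invariant formula for the exterior derivative of a 2-form. -/
  closed : ∀ X Y Z : ∀ p : M, TangentSpace (𝓡 (2 * n)) p,
    IsSmoothField X → IsSmoothField Y → IsSmoothField Z → ∀ p : M,
      dirDeriv (fun q => Ω q (Y q) (Z q)) p (X p)
        - dirDeriv (fun q => Ω q (X q) (Z q)) p (Y p)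
        + dirDeriv (fun q => Ω q (X q) (Y q)) p (Z p)
        - Ω p (VectorField.mlieBracket (𝓡 (2 * n)) X Y p) (Z p)
        + Ω p (VectorField.mlieBracket (𝓡 (2 * n)) X Z p) (Y p)
        - Ω p (VectorField.mlieBracket (𝓡 (2 * n)) Y Z p) (X p) = 0
  /-- The torus acts by symplectomorphisms. -/
  invariant_Ω : ∀ (t : Fin n → Circle) (p : M) (v w : TangentSpace (𝓡 (2 * n)) p),
    Ω (t • p) (actDeriv t p v) (actDeriv t p w) = Ω p v w
  /-- The components of the moment map with respect to `e`. -/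
  μ : M → (Fin n → ℝ)
  smooth_μ : ContMDiff (𝓡 (2 * n)) 𝓘(ℝ, Fin n → ℝ) ∞ μ
  invariant_μ : ∀ (t : Fin n → Circle) (p : M), μ (t • p) = μ p
  /-- `Ω (X_j, ·) = -dμ_j`, the sign for which `Ω = ∑ dμ_j ∧ dθ_j` in action-angle coordinates. -/
  hamiltonian : ∀ (j : Fin n) (p : M) (v : TangentSpace (𝓡 (2 * n)) p),
    Ω p (fundField (e j) p) v = -dirDeriv (fun q => μ q j) p v

variable {n M}

variable {e : Module.Basis (Fin n) ℝ (Fin n → ℝ)}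

namespace ToricSymplectic

variable (S : ToricSymplectic n M e)

/-- The moment polytope `Δ`, the image of the moment map. -/
def polytope : Set (Fin n → ℝ) := Set.range S.μ

/-- The preimage `M°` of the interior of the moment polytope. -/
def openPart : Set M := S.μ ⁻¹' interior S.polytope

/-- `I` is a toric Kähler structure: a complex structure on `M` (smooth, `I² = -1`, and with
vanishing Nijenhuis tensor) that is compatible with `Ω` and invariant under the torus. -/
structure IsToricKahler
    (I : ∀ p : M, TangentSpace (𝓡 (2 * n)) p →L[ℝ] TangentSpace (𝓡 (2 * n)) p) : Prop where
  smooth : ContMDiff (𝓡 (2 * n)) ((𝓡 (2 * n)).prod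
      𝓘(ℝ, EuclideanSpace ℝ (Fin (2 * n)) →L[ℝ] EuclideanSpace ℝ (Fin (2 * n)))) ∞
    (fun p => Bundle.TotalSpace.mk'
      (EuclideanSpace ℝ (Fin (2 * n)) →L[ℝ] EuclideanSpace ℝ (Fin (2 * n)))
      (E := fun p : M => TangentSpace (𝓡 (2 * n)) p →L[ℝ] TangentSpace (𝓡 (2 * n)) p)
      p (I p))
  sq_eq_neg : ∀ (p : M) (v : TangentSpace (𝓡 (2 * n)) p), I p (I p v) = -v
  integrable : ∀ X Y : ∀ p : M, TangentSpace (𝓡 (2 * n)) p,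
    IsSmoothField X → IsSmoothField Y → ∀ p : M,
      VectorField.mlieBracket (𝓡 (2 * n)) (fun q => I q (X q)) (fun q => I q (Y q)) p
        = VectorField.mlieBracket (𝓡 (2 * n)) X Y p
          + I p (VectorField.mlieBracket (𝓡 (2 * n)) (fun q => I q (X q)) Y p
            + VectorField.mlieBracket (𝓡 (2 * n)) X (fun q => I q (Y q)) p)
  compatible : ∀ (p : M) (v w : TangentSpace (𝓡 (2 * n)) p), S.Ω p (I p v) (I p w) = S.Ω p v w
  positive : ∀ (p : M) (v : TangentSpace (𝓡 (2 * n)) p), v ≠ 0 → 0 < S.Ω p v (I p v)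
  invariant : ∀ (t : Fin n → Circle) (p : M) (v : TangentSpace (𝓡 (2 * n)) p),
    actDeriv t p (I p v) = I (t • p) (actDeriv t p v)

end ToricSymplectic

/-- The Hessian matrix of second partial derivatives of `τ`. -/
def hessian (τ : (Fin n → ℝ) → ℝ) (x : Fin n → ℝ) : Matrix (Fin n) (Fin n) ℝ :=
  Matrix.of fun j k => fderiv ℝ (fun y => fderiv ℝ τ y (Pi.single k 1)) x (Pi.single j 1)

namespace ToricSymplectic

variable (S : ToricSymplectic n M e)

/-- `τ` is a symplectic potential of `I`.  If `(ζ_j, ϑ_j)` is the coframe on `M°` that is dual to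
the frame `(X_j, I X_j)`, this means that `ϑ_j = -∑ k, φ_jk(μ) dμ_k`, where `φ` is the Hessian
of `τ`; that is, these 1-forms take the values `0` on `X_l` and `δ_jl` on `I X_l`.  Only the values
of `τ` on the interior of the moment polytope matter. -/
structure IsSymplecticPotential
    (I : ∀ p : M, TangentSpace (𝓡 (2 * n)) p →L[ℝ] TangentSpace (𝓡 (2 * n)) p)
    (τ : (Fin n → ℝ) → ℝ) : Prop where
  smooth : ContDiffOn ℝ ∞ τ (interior S.polytope)
  coframe_fund : ∀ p ∈ S.openPart, ∀ j l : Fin n,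
    -∑ k, hessian τ (S.μ p) j k * dirDeriv (fun q => S.μ q k) p (fundField (e l) p) = 0
  coframe_rot : ∀ p ∈ S.openPart, ∀ j l : Fin n,
    -∑ k, hessian τ (S.μ p) j k * dirDeriv (fun q => S.μ q k) p (I p (fundField (e l) p))
      = if j = l then 1 else 0

/-- The matrix function `φ_s⁻¹`, where `φ_s` is the Hessian of `τ`, as a torus-invariant function
on the whole of `M`: on `M°` it is the inverse of the Hessian at `μ p`, elsewhere it is the
extension by continuity from `M°`.  (Functions on `Δ = M / 𝕋` are identified with torus-invariant
functions on `M`.) -/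
def hessInv (τ : (Fin n → ℝ) → ℝ) : M → Matrix (Fin n) (Fin n) ℝ :=
  extendFrom S.openPart fun p => (hessian τ (S.μ p))⁻¹

/-- The nonnegative square root `φ_s^(-1/2)` of `φ_s⁻¹`. -/
def hessInvSqrt (τ : (Fin n → ℝ) → ℝ) (p : M) : Matrix (Fin n) (Fin n) ℝ :=
  CFC.sqrt (S.hessInv τ p)

/-- The set `𝒜_τ` of the antisymmetric matrices `F` for which
`1 + 1/4 (φ_s^(-1/2) F φ_s^(-1/2))²` is positive definite everywhere on `Δ = M / 𝕋`. -/
def admissible (τ : (Fin n → ℝ) → ℝ) : Set (AntisymMat n) :=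
  {F | ∀ p : M, (1 + (1 / 4 : ℝ) •
    (S.hessInvSqrt τ p * F.toMat * S.hessInvSqrt τ p) ^ 2).PosDef}

end ToricSymplectic

end Manifold

end ToricKahler

end

noncomputable section

namespace ToricKahler

/-! ### Linear algebra of the admissible set -/

section LinearAlgebra

variable {n : ℕ}

/-! Write `S` for `φ_s^(-1/2)` at a point. Since `K = S F S` is antisymmetric, `K² = -KᵀK`, and `1 +
K²/4` is positive definite exactly when `‖K v‖ < 2 ‖v‖` for all `v ≠ 0` (`posDef_one_add_sq_iff`).
Each such condition is convex in `F` and holds at `0`, which gives convexity and the cone property.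
Openness follows once the matrices `S` form a compact set, and boundedness once a single `S` is
invertible.

Both facts come from identifying the continuous extension of `φ_s⁻¹` with the Gram matrix `Ω (X_k, I
X_l)` (`hessInv_eq_gram`). That matrix is continuous and positive semidefinite on the whole compact
`M`, and it inverts the Hessian on `M°`. Its values form a compact set, and so do their nonnegative
square roots (`isCompact_sqrt`).

The identification outside `M°` requires `M°` to be dense (`dense_openPart`). Where the fundamental
fields are independent, nondegeneracy of `Ω` makes `μ` a submersion, so the point lies in `M°`. Any
other point is fixed by a one-parameter subgroup, hence by an element of order two in its closure
(`exists_torsionTwo_mem`). There are only finitely many such elements, and by effectiveness and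
connectedness each has a fixed set with empty interior (`eq_self_of_involutive`). Order two is
convenient because a `C¹` involution can be handled by its derivative alone, without an invariant
metric. -/

instance : FiniteDimensional ℝ (AntisymMat n) :=
  inferInstanceAs (FiniteDimensional ℝ (antisymSubmodule n))

/-- The inclusion of the antisymmetric matrices into all matrices. -/
def AntisymMat.toMatLinear (n : ℕ) : AntisymMat n →ₗ[ℝ] Matrix (Fin n) (Fin n) ℝ where
  toFun := AntisymMat.toMat
  map_add' := AntisymMat.toMat_add
  map_smul' := AntisymMat.toMat_smul

theorem AntisymMat.continuous_toMat :
    Continuous (AntisymMat.toMat : AntisymMat n → Matrix (Fin n) (Fin n) ℝ) :=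
  (AntisymMat.toMatLinear n).continuous_of_finiteDimensional

/-- For symmetric `S` and antisymmetric `F` the product `S F S` is antisymmetric. -/
theorem transpose_mul_antisymm_mul {S : Matrix (Fin n) (Fin n) ℝ} (hS : Sᵀ = S)
    (F : AntisymMat n) : (S * F.toMat * S)ᵀ = -(S * F.toMat * S) := by
  rw [Matrix.transpose_mul, Matrix.transpose_mul, hS, F.toMat_transpose]
  simp [Matrix.mul_assoc]

/-- For antisymmetric `K`, positivity of `1 + K² / 4` is the bound `‖K v‖ < 2 ‖v‖`. -/
theorem posDef_one_add_sq_iff {K : Matrix (Fin n) (Fin n) ℝ} (hK : Kᵀ = -K) :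
    (1 + (1 / 4 : ℝ) • K ^ 2).PosDef ↔
      ∀ v : EuclideanSpace ℝ (Fin n), v ≠ 0 →
        ‖Matrix.toEuclideanCLM (𝕜 := ℝ) K v‖ < 2 * ‖v‖ := by
  have hherm : (1 + (1 / 4 : ℝ) • K ^ 2).IsHermitian := by
    rw [Matrix.IsHermitian, Matrix.conjTranspose_eq_transpose_of_trivial, Matrix.transpose_add,
      Matrix.transpose_smul, Matrix.transpose_pow, hK]
    simp
  have hform (v : EuclideanSpace ℝ (Fin n)) :
      (v.ofLp ⬝ᵥ ((1 + (1 / 4 : ℝ) • K ^ 2) *ᵥ v.ofLp)) =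
        ‖v‖ ^ 2 - (1 / 4) * ‖Matrix.toEuclideanCLM (𝕜 := ℝ) K v‖ ^ 2 := by
    rw [EuclideanSpace.real_norm_sq_eq, EuclideanSpace.real_norm_sq_eq]
    have h1 : v.ofLp ⬝ᵥ (K ^ 2 *ᵥ v.ofLp) = -((K *ᵥ v.ofLp) ⬝ᵥ (K *ᵥ v.ofLp)) := by
      rw [sq, ← Matrix.mulVec_mulVec, Matrix.dotProduct_mulVec, ← Matrix.mulVec_transpose, hK,
        Matrix.neg_mulVec, neg_dotProduct]
    rw [Matrix.add_mulVec, Matrix.smul_mulVec, dotProduct_add, dotProduct_smul, h1]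
    simp [dotProduct, sq]
    ring
  constructor
  · intro h v hv
    have h0 := h.dotProduct_mulVec_pos (x := v.ofLp) (by simpa using hv)
    rw [star_trivial, hform] at h0
    nlinarith [norm_nonneg v, norm_nonneg (Matrix.toEuclideanCLM (𝕜 := ℝ) K v)]
  · intro h
    refine Matrix.PosDef.of_dotProduct_mulVec_pos hherm fun x hx => ?_
    have h0 := h (WithLp.toLp 2 x) (by simpa using hx)
    have h1 := hform (WithLp.toLp 2 x)
    rw [star_trivial]
    simp only at h1
    rw [h1]
    nlinarith [norm_nonneg (WithLp.toLp 2 x),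
      norm_nonneg (Matrix.toEuclideanCLM (𝕜 := ℝ) K (WithLp.toLp 2 x))]

/-- The antisymmetric `F` for which `1 + (S F S)² / 4` is positive definite for all `S ∈ 𝒮`. -/
def admissibleFor (𝒮 : Set (Matrix (Fin n) (Fin n) ℝ)) : Set (AntisymMat n) :=
  {F | ∀ S ∈ 𝒮, (1 + (1 / 4 : ℝ) • (S * F.toMat * S) ^ 2).PosDef}

variable {𝒮 : Set (Matrix (Fin n) (Fin n) ℝ)}

theorem mem_admissibleFor_iff (h𝒮 : ∀ S ∈ 𝒮, Sᵀ = S) (F : AntisymMat n) :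
    F ∈ admissibleFor 𝒮 ↔ ∀ S ∈ 𝒮, ∀ v : EuclideanSpace ℝ (Fin n), v ≠ 0 →
        ‖Matrix.toEuclideanCLM (𝕜 := ℝ) (S * F.toMat * S) v‖ < 2 * ‖v‖ :=
  forall₂_congr fun S hS => posDef_one_add_sq_iff (transpose_mul_antisymm_mul (h𝒮 S hS) F)

theorem zero_mem_admissibleFor : (0 : AntisymMat n) ∈ admissibleFor 𝒮 := by
  intro S _
  have : (0 : AntisymMat n).toMat = 0 := rfl
  simpa [this] using Matrix.PosDef.one

/-- For fixed `S` and `v` the function `F ↦ ‖S F S v‖` is a seminorm, so its strict sublevel sets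
are convex. -/
theorem convex_admissibleFor (h𝒮 : ∀ S ∈ 𝒮, Sᵀ = S) : Convex ℝ (admissibleFor 𝒮) := by
  intro F hF G hG a b ha hb hab
  rw [mem_admissibleFor_iff h𝒮] at hF hG ⊢
  intro S hS v hv
  have h1 := hF S hS v hv
  have h2 := hG S hS v hv
  have e : S * (a • F + b • G).toMat * S = a • (S * F.toMat * S) + b • (S * G.toMat * S) := by
    rw [AntisymMat.toMat_add, AntisymMat.toMat_smul, AntisymMat.toMat_smul]
    simp [Matrix.mul_add, Matrix.add_mul]
  rw [e, map_add, map_smul, map_smul, add_apply,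
    smul_apply, smul_apply]
  refine (norm_add_le _ _).trans_lt ?_
  rw [norm_smul, norm_smul, Real.norm_of_nonneg ha, Real.norm_of_nonneg hb]
  exact convex_Iio (2 * ‖v‖) h1 h2 ha hb hab

theorem continuous_norm_toEuclideanCLM_mul : Continuous fun z : AntisymMat n ×
    (Matrix (Fin n) (Fin n) ℝ × EuclideanSpace ℝ (Fin n)) =>
      ‖Matrix.toEuclideanCLM (𝕜 := ℝ) (z.2.1 * z.1.toMat * z.2.1) z.2.2‖ := by
  have heq (A : Matrix (Fin n) (Fin n) ℝ) (v : EuclideanSpace ℝ (Fin n)) :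
      Matrix.toEuclideanCLM (𝕜 := ℝ) A v = WithLp.toLp 2 (A *ᵥ v.ofLp) :=
    Matrix.toEuclideanCLM_toLp A v.ofLp
  simp only [heq]
  have := AntisymMat.continuous_toMat (n := n)
  refine ((PiLp.continuous_toLp 2 _).comp ?_).norm
  exact ((continuous_snd.fst.matrix_mul (this.comp continuous_fst)).matrix_mul
    continuous_snd.fst).matrix_mulVec ((PiLp.continuous_ofLp 2 _).comp continuous_snd.snd)

/-- Homogeneity in `v` reduces the condition to unit vectors, so that the parameters `(S, v)` range
over a compact set when `𝒮` is compact. -/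
theorem admissibleFor_eq_sphere (h𝒮 : ∀ S ∈ 𝒮, Sᵀ = S) :
    admissibleFor 𝒮 = {F | ∀ q ∈ 𝒮 ×ˢ Metric.sphere (0 : EuclideanSpace ℝ (Fin n)) 1,
      ‖Matrix.toEuclideanCLM (𝕜 := ℝ) (q.1 * F.toMat * q.1) q.2‖ < 2} := by
  ext F
  rw [mem_admissibleFor_iff h𝒮]
  constructor
  · rintro h ⟨S, v⟩ ⟨hS, hv⟩
    have hv1 : ‖v‖ = 1 := mem_sphere_zero_iff_norm.1 hv
    have := h S hS v (by rintro rfl; simp at hv1)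
    rwa [hv1, mul_one] at this
  · intro h S hS v hv
    have hv' : 0 < ‖v‖ := norm_pos_iff.2 hv
    have h1 : ‖v‖⁻¹ • v ∈ Metric.sphere (0 : EuclideanSpace ℝ (Fin n)) 1 := by
      rw [mem_sphere_zero_iff_norm, norm_smul, norm_inv, norm_norm, inv_mul_cancel₀ hv'.ne']
    have h0 := h (S, ‖v‖⁻¹ • v) ⟨hS, h1⟩
    rw [map_smul, norm_smul, norm_inv, norm_norm] at h0
    rwa [inv_mul_lt_iff₀ hv', mul_comm] at h0

/-- This is the tube lemma: a strict inequality that holds along `{x} × K` persists near `x`,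
uniformly over the compact `K`. -/
theorem isOpen_setOf_forall_mem_compact {X Y : Type*} [TopologicalSpace X] [TopologicalSpace Y]
    {K : Set Y} (hK : IsCompact K) {f : X × Y → ℝ} (hf : Continuous f) (c : ℝ) :
    IsOpen {x | ∀ y ∈ K, f (x, y) < c} := by
  rw [isOpen_iff_mem_nhds]
  intro x hx
  refine hK.eventually_forall_of_forall_eventually fun y hy => ?_
  exact hf.continuousAt.eventually (gt_mem_nhds (hx y hy))

theorem isOpen_admissibleFor (h𝒮 : ∀ S ∈ 𝒮, Sᵀ = S) (hc : IsCompact 𝒮) :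
    IsOpen (admissibleFor 𝒮) := by
  rw [admissibleFor_eq_sphere h𝒮]
  exact isOpen_setOf_forall_mem_compact (hc.prod (isCompact_sphere _ _))
    continuous_norm_toEuclideanCLM_mul 2

/-- For invertible `S` the linear map `F ↦ S F S` is injective on a finite-dimensional space, hence
antilipschitz, and it sends admissible `F` into the ball of radius 2 for the operator norm. -/
theorem isBounded_admissibleFor (h𝒮 : ∀ S ∈ 𝒮, Sᵀ = S) {S : Matrix (Fin n) (Fin n) ℝ}
    (hS : S ∈ 𝒮) (hu : IsUnit S) : Bornology.IsBounded (admissibleFor 𝒮) := by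
  let L : AntisymMat n →ₗ[ℝ] (EuclideanSpace ℝ (Fin n) →L[ℝ] EuclideanSpace ℝ (Fin n)) :=
    { toFun := fun F => Matrix.toEuclideanCLM (𝕜 := ℝ) (S * F.toMat * S)
      map_add' := fun F G => by
        rw [AntisymMat.toMat_add, Matrix.mul_add, Matrix.add_mul, map_add]
      map_smul' := fun c F => by
        rw [AntisymMat.toMat_smul, Matrix.mul_smul, Matrix.smul_mul, map_smul, RingHom.id_apply] }
  have hinj : LinearMap.ker L = ⊥ := by
    refine LinearMap.ker_eq_bot.2 fun F G h => AntisymMat.toMat_injective ?_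
    exact hu.mul_left_cancel (hu.mul_right_cancel ((Matrix.toEuclideanCLM (𝕜 := ℝ)).injective h))
  obtain ⟨C, -, hC⟩ := L.exists_antilipschitzWith hinj
  refine (hC.isBounded_preimage (Metric.isBounded_closedBall (x := 0) (r := 2))).subset ?_
  intro F hF
  rw [mem_admissibleFor_iff h𝒮] at hF
  rw [Set.mem_preimage, mem_closedBall_zero_iff]
  refine ContinuousLinearMap.opNorm_le_bound _ zero_le_two fun v => ?_
  rcases eq_or_ne v 0 with rfl | hv
  · simp
  · exact (hF S hS v hv).le

/-- The nonnegative square roots of the elements of a compact set of matrices. -/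
theorem isCompact_sqrt {K : Set (Matrix (Fin n) (Fin n) ℝ)} (hK : IsCompact K) :
    IsCompact {S : Matrix (Fin n) (Fin n) ℝ | S.PosSemidef ∧ S * S ∈ K} := by
  have hclosed : IsClosed {S : Matrix (Fin n) (Fin n) ℝ | S.PosSemidef ∧ S * S ∈ K} := by
    refine IsClosed.inter ?_ (hK.isClosed.preimage (continuous_id.matrix_mul continuous_id))
    have : {S : Matrix (Fin n) (Fin n) ℝ | S.PosSemidef} =
        {S | Sᵀ = S} ∩ ⋂ x : Fin n → ℝ, {S | 0 ≤ x ⬝ᵥ (S *ᵥ x)} := by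
      ext S
      simp [Matrix.posSemidef_iff_dotProduct_mulVec, Matrix.IsHermitian,
        Matrix.conjTranspose_eq_transpose_of_trivial]
    change IsClosed {S : Matrix (Fin n) (Fin n) ℝ | S.PosSemidef}
    rw [this]
    refine (isClosed_eq continuous_id.matrix_transpose continuous_id).inter
      (isClosed_iInter fun x => isClosed_le continuous_const ?_)
    exact continuous_const.dotProduct (continuous_id.matrix_mulVec continuous_const)
  -- For symmetric `S` the trace of `S²` is the sum of the squares of the entries, so a bound `C`
  -- for the trace on `K` bounds every entry by `√C`.
  obtain ⟨C, hC⟩ := hK.bddAbove_image (f := Matrix.trace) continuous_id.matrix_trace.continuousOn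
  refine IsCompact.of_isClosed_subset (s := {S : Matrix (Fin n) (Fin n) ℝ |
    ∀ i j, S i j ∈ Set.Icc (-√C) (√C)}) ?_ hclosed ?_
  · have h := isCompact_univ_pi fun _ : Fin n => isCompact_univ_pi fun _ : Fin n =>
      isCompact_Icc (a := -√C) (b := √C)
    simp only [Set.pi, Set.mem_univ, true_imp_iff, Set.mem_ofPred_eq] at h
    exact h
  · rintro S ⟨hS, hSK⟩ i j
    have hT : Sᵀ = S := hS.1
    have h1 : (S * S).trace ≤ C := hC ⟨_, hSK, rfl⟩
    have h2 : (S * S).trace = ∑ i, ∑ j, S i j ^ 2 := by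
      nth_rewrite 2 [← hT]
      simp [Matrix.trace, Matrix.mul_apply, sq]
    have h3 : S i j ^ 2 ≤ ∑ i, ∑ j, S i j ^ 2 :=
      (Finset.single_le_sum (f := fun j => S i j ^ 2) (fun _ _ => sq_nonneg _)
        (Finset.mem_univ j)).trans
      (Finset.single_le_sum (f := fun i => ∑ j, S i j ^ 2)
        (fun _ _ => Finset.sum_nonneg fun _ _ => sq_nonneg _) (Finset.mem_univ i))
    exact abs_le.1 (Real.abs_le_sqrt (by linarith))

end LinearAlgebra

/-! ### Elements of order two in one-parameter subgroups of a torus -/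

section Torus

variable {n : ℕ}

theorem torusExp_add (ξ η : Fin n → ℝ) : torusExp (ξ + η) = torusExp ξ * torusExp η := by
  ext j : 1
  exact Circle.exp_add _ _

theorem torusExp_zero : torusExp (0 : Fin n → ℝ) = 1 := by
  ext j : 1
  exact Circle.exp_zero

theorem continuous_torusExp : Continuous (torusExp : (Fin n → ℝ) → Fin n → Circle) :=
  continuous_pi fun j => Circle.exp.continuous.comp (continuous_apply j)

theorem surjective_torusExp : Function.Surjective (torusExp : (Fin n → ℝ) → Fin n → Circle) := by
  intro t
  exact ⟨fun j => Complex.arg (t j), funext fun j => Circle.exp_arg (t j)⟩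

theorem isOpenQuotientMap_torusExp :
    IsOpenQuotientMap (torusExp : (Fin n → ℝ) → Fin n → Circle) :=
  IsOpenQuotientMap.piMap fun _ : Fin n =>
    ⟨Circle.exp_surjective, Circle.exp.continuous, isLocalHomeomorph_circleExp.isOpenMap⟩

/-- Simultaneous Diophantine approximation of a nonzero vector by nonzero integer vectors. -/
theorem exists_int_approx {η : Fin n → ℝ} (hη : η ≠ 0) {ε : ℝ} (hε : 0 < ε) :
    ∃ (s : ℝ) (m : Fin n → ℤ), m ≠ 0 ∧ ∀ j, |s * η j - m j| < ε := by
  obtain ⟨i, hi⟩ := Function.ne_iff.1 hη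
  have hi' : 0 < |η i| := abs_pos.2 hi
  have hmem (k : ℕ) : (fun j => Int.fract (k * η j)) ∈
      Set.pi Set.univ fun _ : Fin n => Set.Icc (0 : ℝ) 1 :=
    fun j _ => ⟨Int.fract_nonneg _, (Int.fract_lt_one _).le⟩
  obtain ⟨a, -, φ, hφ, ha⟩ :=
    (isCompact_univ_pi fun _ : Fin n => isCompact_Icc (a := (0 : ℝ)) (b := 1)).tendsto_subseq hmem
  -- Two fractional parts that are close give the approximation. The tolerance `|η i|` forces the
  -- `i`-th integer to be nonzero: the two multipliers differ by at least 1, so a zero there would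
  -- leave an error of at least `|η i|`.
  obtain ⟨N, hN⟩ := Metric.cauchySeq_iff'.1 ha.cauchySeq (min ε |η i|) (lt_min hε hi')
  have hlt : φ N < φ (N + 1) := hφ (Nat.lt_succ_self N)
  have h := hN (N + 1) (Nat.le_succ N)
  have h' (j : Fin n) : |((φ (N + 1) : ℝ) - φ N) * η j -
      ((⌊φ (N + 1) * η j⌋ - ⌊φ N * η j⌋ : ℤ) : ℝ)| < min ε |η i| := by
    have := (dist_le_pi_dist _ _ j).trans_lt h
    simp only [Function.comp_apply, Real.dist_eq, Int.fract] at this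
    rw [show ((φ (N + 1) : ℝ) - φ N) * η j -
      ((⌊φ (N + 1) * η j⌋ - ⌊φ N * η j⌋ : ℤ) : ℝ) = φ (N + 1) * η j - ⌊φ (N + 1) * η j⌋ -
        (φ N * η j - ⌊φ N * η j⌋) by push_cast; ring]
    exact this
  refine ⟨(φ (N + 1) : ℝ) - φ N, fun j => ⌊φ (N + 1) * η j⌋ - ⌊φ N * η j⌋, ?_,
    fun j => (h' j).trans_le (min_le_left _ _)⟩
  intro h0
  have h1 := (h' i).trans_le (min_le_right _ _)
  have h2 : (⌊φ (N + 1) * η i⌋ - ⌊φ N * η i⌋ : ℤ) = 0 := congrFun h0 i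
  rw [h2, Int.cast_zero, sub_zero, abs_mul] at h1
  have h3 : (1 : ℝ) ≤ (φ (N + 1) : ℝ) - φ N := by
    have : (φ N : ℝ) + 1 ≤ φ (N + 1) := by exact_mod_cast hlt
    linarith
  rw [abs_of_pos (by linarith)] at h1
  nlinarith

/-- As `exists_int_approx`, with an integer vector that has an odd entry. -/
theorem exists_odd_approx {η : Fin n → ℝ} (hη : η ≠ 0) {ε : ℝ} (hε : 0 < ε) :
    ∃ (s : ℝ) (m : Fin n → ℤ), (∃ j, Odd (m j)) ∧ ∀ j, |s * η j - m j| < ε := by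
  obtain ⟨s, m, hm, h⟩ := exists_int_approx hη hε
  obtain ⟨i, hi⟩ := Function.ne_iff.1 hm
  -- If every entry is even, halving `s` and `m` halves the errors too; the descent ends because `m
  -- i ≠ 0`.
  induction hN : (m i).natAbs using Nat.strong_induction_on generalizing s m with
  | _ N ih =>
    by_cases hodd : ∃ j, Odd (m j)
    · exact ⟨s, m, hodd, h⟩
    · simp only [not_exists, Int.not_odd_iff_even] at hodd
      choose r hr using hodd
      have hri : r i ≠ 0 := by
        intro h0
        exact hi (by rw [hr i, h0]; rfl)
      refine ih (r i).natAbs ?_ (s / 2) r ?_ ?_ hri rfl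
      · have := hr i
        omega
      · exact fun h0 => hri (congrFun h0 i)
      · intro j
        have h1 := h j
        rw [hr j] at h1
        push_cast at h1
        have : s / 2 * η j - r j = (s * η j - (r j + r j)) / 2 := by ring
        rw [this, abs_div, abs_two]
        have := abs_nonneg (s * η j - (r j + r j))
        linarith

/-- The elements of order two of the torus. -/
def torsionTwo (n : ℕ) : Set (Fin n → Circle) := {t | t ≠ 1 ∧ t * t = 1}

theorem circle_exp_pi_ne_one : Circle.exp Real.pi ≠ 1 := by
  rw [Ne, Circle.ext_iff]
  simp only [Circle.coe_exp, Complex.exp_pi_mul_I, Circle.coe_one]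
  norm_num

theorem circle_exp_int_mul_pi_sq (m : ℤ) :
    Circle.exp (m * Real.pi) * Circle.exp (m * Real.pi) = 1 := by
  rw [← Circle.exp_add, ← two_mul, ← mul_assoc, mul_comm (2 : ℝ), mul_assoc]
  exact Circle.exp_int_mul_two_pi m

theorem circle_mul_self_eq_one {z : Circle} (h : z * z = 1) : z = 1 ∨ z = Circle.exp Real.pi := by
  have h' : (z : ℂ) * z = 1 := by simpa using congrArg (fun w : Circle => (w : ℂ)) h
  rcases mul_self_eq_one_iff.1 h' with h1 | h1
  · left; ext; simpa using h1
  · right; ext; simpa [Circle.coe_exp, Complex.exp_pi_mul_I] using h1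

theorem finite_torsionTwo (n : ℕ) : (torsionTwo n).Finite := by
  refine (Set.Finite.pi' (t := fun _ : Fin n => ({1, Circle.exp Real.pi} : Set Circle))
    fun _ => by simp).subset ?_
  intro t ht j
  exact circle_mul_self_eq_one (congrFun ht.2 j)

theorem torusExp_int_mem_torsionTwo {m : Fin n → ℤ} (hm : ∃ j, Odd (m j)) :
    torusExp (fun j => m j * Real.pi) ∈ torsionTwo n := by
  constructor
  · obtain ⟨j, r, hr⟩ := hm
    intro h
    apply circle_exp_pi_ne_one
    have h1 : Circle.exp (m j * Real.pi) = 1 := congrFun h j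
    rw [hr] at h1
    push_cast at h1
    rwa [show (2 * (r : ℝ) + 1) * Real.pi = r * (2 * Real.pi) + Real.pi by ring, Circle.exp_add,
      Circle.exp_int_mul_two_pi, one_mul] at h1
  · exact funext fun j => circle_exp_int_mul_pi_sq (m j)

/-- A closed set that contains a nontrivial one-parameter subgroup of a torus contains an element
of order two. -/
theorem exists_torsionTwo_mem {H : Set (Fin n → Circle)} (hH : IsClosed H) {ξ : Fin n → ℝ}
    (hξ : ξ ≠ 0) (hmem : ∀ s : ℝ, torusExp (s • ξ) ∈ H) : ∃ t ∈ torsionTwo n, t ∈ H := by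
  have happrox (k : ℕ) : ∃ (s : ℝ) (m : Fin n → ℤ), (∃ j, Odd (m j)) ∧
      ∀ j, |s * ξ j - m j * Real.pi| < 1 / ((k : ℝ) + 1) := by
    have hη : (Real.pi⁻¹ • ξ) ≠ 0 := smul_ne_zero (inv_ne_zero Real.pi_ne_zero) hξ
    have hε : (0 : ℝ) < 1 / ((k : ℝ) + 1) / Real.pi := by positivity
    obtain ⟨s, m, hm, h⟩ := exists_odd_approx hη hε
    refine ⟨s, m, hm, fun j => ?_⟩
    have h1 := h j
    rw [lt_div_iff₀ Real.pi_pos] at h1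
    rwa [← abs_of_pos Real.pi_pos, ← abs_mul, abs_of_pos Real.pi_pos, sub_mul,
      show s * (Real.pi⁻¹ • ξ) j * Real.pi = s * ξ j by
        simp only [Pi.smul_apply, smul_eq_mul]; field_simp] at h1
  choose s m hodd happ using happrox
  have hfin := (finite_torsionTwo n).isCompact
  -- The points `exp (π m_k)` lie in a finite set, so a subsequence converges to an element `t` of
  -- order two. As `s_k ξ - π m_k` tends to 0, the points `exp (s_k ξ)` of `H` converge to `t` along
  -- it.
  obtain ⟨t, ht, φ, hφ, hlim⟩ := hfin.tendsto_subseq fun k => torusExp_int_mem_torsionTwo (hodd k)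
  refine ⟨t, ht, ?_⟩
  have hd : Filter.Tendsto (fun k => s k • ξ - fun j => m k j * Real.pi) Filter.atTop (𝓝 0) := by
    rw [tendsto_pi_nhds]
    intro j
    refine squeeze_zero_norm (fun k => ?_) tendsto_one_div_add_atTop_nhds_zero_nat
    exact (happ k j).le
  have h1 := ((continuous_torusExp.tendsto 0).comp (hd.comp hφ.tendsto_atTop)).mul hlim
  rw [torusExp_zero, one_mul] at h1
  refine hH.mem_of_tendsto h1 (Filter.Eventually.of_forall fun k => ?_)
  simp only [Function.comp_apply, ← torusExp_add, sub_add_cancel]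
  exact hmem _

end Torus

/-! ### Smooth involutions and submersions -/

section Involution

open Filter

/-- An involution of class `C¹` that is the identity on open sets accumulating at `x` is the
identity near `x`. -/
theorem eventually_eq_self_of_involutive {E : Type*} [NormedAddCommGroup E] [NormedSpace ℝ E]
    {f : E → E} {x : E} (hf : ContDiffAt ℝ 1 f x) (hfx : f x = x)
    (hinv : ∀ᶠ y in 𝓝 x, f (f y) = y) (hfreq : ∃ᶠ y in 𝓝 x, ∀ᶠ z in 𝓝 y, f z = z) :
    ∀ᶠ y in 𝓝 x, f y = y := by
  -- The derivative is the identity on the open sets where `f` is, and it is continuous at `x`, a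
  -- point of accumulation of them.
  have hderiv : fderiv ℝ f x = ContinuousLinearMap.id ℝ E := by
    by_contra hne
    have hcont := hf.continuousAt_fderiv one_ne_zero
    have hev := hcont.eventually_ne hne
    obtain ⟨y, hy, hy'⟩ := (hfreq.and_eventually hev).exists
    apply hy'
    have : f =ᶠ[𝓝 y] id := hy
    rw [this.fderiv_eq, fderiv_id]
  have hstrict := (hf.hasStrictFDerivAt one_ne_zero).sub (hasStrictFDerivAt_id x)
  rw [hderiv, sub_self] at hstrict
  -- Near `x` the map `f - id` is Lipschitz with constant 1/2. Comparing its values at `f y` and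
  -- `y`, with `f (f y) = y`, gives `2 ‖f y - y‖ ≤ ‖f y - y‖ / 2`.
  have hlip := hstrict.isLittleO.def (c := 1 / 2) (by norm_num)
  have htend : Tendsto (fun y => (f y, y)) (𝓝 x) (𝓝 (x, x)) := by
    have := hf.continuousAt.tendsto.prodMk_nhds (tendsto_id (α := E) (x := 𝓝 x))
    rwa [hfx] at this
  filter_upwards [htend.eventually hlip, hinv] with y hy hy2
  simp only [Pi.sub_apply, id, zero_apply, sub_zero, hy2] at hy
  have e : y - f y - (f y - y) = (-2 : ℝ) • (f y - y) := by
    rw [neg_smul, two_smul]; abel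
  rw [e, norm_smul] at hy
  norm_num at hy
  have := norm_nonneg (f y - y)
  exact sub_eq_zero.1 (norm_eq_zero.1 (by linarith))

/-- A smooth involution of a connected manifold that fixes a nonempty open set is the identity. -/
theorem eq_self_of_involutive {E M : Type*} [NormedAddCommGroup E] [NormedSpace ℝ E]
    [TopologicalSpace M] [ChartedSpace E M] [T2Space M] [PreconnectedSpace M]
    {σ : M → M} (hσ : ContMDiff 𝓘(ℝ, E) 𝓘(ℝ, E) 1 σ) (hinv : ∀ p, σ (σ p) = p)
    (hne : (interior {p | σ p = p}).Nonempty) (p : M) : σ p = p := by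
  have hclosed : IsClosed {p | σ p = p} := isClosed_eq hσ.continuous continuous_id
  -- The interior of the fixed set is nonempty and open; if it is also closed, connectedness makes
  -- it everything. Closedness is a local question at a limit point `p`, settled in a chart.
  suffices h : IsClosed (interior {p | σ p = p}) by
    have huniv := IsClopen.eq_univ ⟨h, isOpen_interior⟩ hne
    exact interior_subset (s := {p | σ p = p}) (by rw [huniv]; trivial)
  refine isClosed_of_closure_subset fun p hp => ?_
  have hpp : σ p = p := closure_minimal interior_subset hclosed hp
  set φ := extChartAt 𝓘(ℝ, E) p with hφ
  have hC : ContDiffAt ℝ 1 (φ ∘ σ ∘ φ.symm) (φ p) := by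
    have := (contMDiffAt_iff.1 (hσ p)).2
    rw [hpp] at this
    simpa only [modelWithCornersSelf_coe, Set.range_id, contDiffWithinAt_univ] using this
  have hsrc : ∀ᶠ q in 𝓝 p, q ∈ φ.source := extChartAt_source_mem_nhds p
  have hσp : Tendsto σ (𝓝 p) (𝓝 p) := by
    simpa only [ContinuousAt, hpp] using hσ.continuous.continuousAt (x := p)
  have hσsrc : ∀ᶠ q in 𝓝 p, σ q ∈ φ.source := hσp.eventually hsrc
  have hmap : map φ (𝓝 p) = 𝓝 (φ p) := map_extChartAt_nhds_of_boundaryless p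
  have hmain : ∀ᶠ y in 𝓝 (φ p), (φ ∘ σ ∘ φ.symm) y = y := by
    refine eventually_eq_self_of_involutive hC ?_ ?_ ?_
    · simp [hφ, hpp]
    · rw [← hmap, eventually_map]
      filter_upwards [hsrc, hσsrc] with q hq hq2
      simp only [Function.comp_apply, φ.left_inv hq, φ.left_inv hq2, hinv]
    · rw [← hmap, frequently_map]
      have hfreq : ∃ᶠ q in 𝓝 p, q ∈ interior {p | σ p = p} := mem_closure_iff_frequently.1 hp
      refine (hfreq.and_eventually hsrc).mono fun q ⟨hq, hqs⟩ => ?_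
      have hsymm : Tendsto φ.symm (𝓝 (φ q)) (𝓝 q) := by
        have := continuousAt_extChartAt_symm' (I := 𝓘(ℝ, E)) hqs
        rwa [ContinuousAt, ← hφ, φ.left_inv hqs] at this
      filter_upwards [hsymm.eventually (mem_interior_iff_mem_nhds.1 hq),
        extChartAt_target_mem_nhds' (I := 𝓘(ℝ, E)) (φ.map_source hqs)] with z hz hzt
      have hz' : σ (φ.symm z) = φ.symm z := hz
      simp only [Function.comp_apply, hz']
      exact φ.right_inv hzt
  rw [← hmap, eventually_map] at hmain
  rw [mem_interior_iff_mem_nhds]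
  filter_upwards [hmain, hsrc, hσsrc] with q hq hq1 hq2
  simp only [Function.comp_apply, φ.left_inv hq1] at hq
  exact φ.injOn hq2 hq1 hq

/-- The value of a smooth map at a point of submersion is interior to the range. -/
theorem mem_interior_range_of_surjective_mfderiv {E F M : Type*} [NormedAddCommGroup E]
    [NormedSpace ℝ E] [CompleteSpace E] [NormedAddCommGroup F] [NormedSpace ℝ F] [CompleteSpace F]
    [TopologicalSpace M] [ChartedSpace E M] {f : M → F} {p : M}
    (hf : ContMDiffAt 𝓘(ℝ, E) 𝓘(ℝ, F) 1 f p)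
    (hsurj : Function.Surjective (mfderiv 𝓘(ℝ, E) 𝓘(ℝ, F) f p)) :
    f p ∈ interior (Set.range f) := by
  set φ := extChartAt 𝓘(ℝ, E) p with hφ
  have hC : ContDiffAt ℝ 1 (f ∘ φ.symm) (φ p) := by
    simpa only [modelWithCornersSelf_coe, Set.range_id, contDiffWithinAt_univ,
      extChartAt_model_space_eq_id, PartialEquiv.refl_coe, Function.id_comp]
      using (contMDiffAt_iff.1 hf).2
  have hd : mfderiv 𝓘(ℝ, E) 𝓘(ℝ, F) f p = fderiv ℝ (f ∘ φ.symm) (φ p) := by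
    rw [(hf.mdifferentiableAt one_ne_zero).mfderiv]
    simp only [writtenInExtChartAt, extChartAt_model_space_eq_id, PartialEquiv.refl_coe,
      Function.id_comp, modelWithCornersSelf_coe, Set.range_id, fderivWithin_univ]
    rfl
  -- A strict derivative that is onto makes the map in the chart open at the point.
  have h := (hC.hasStrictFDerivAt one_ne_zero).map_nhds_eq_of_surj
    (LinearMap.range_eq_top.2 (by rw [← hd]; exact hsurj))
  rw [Function.comp_apply, φ.left_inv (mem_extChartAt_source p)] at h
  rw [mem_interior_iff_mem_nhds, ← h, mem_map]
  exact univ_mem' fun y => ⟨φ.symm y, rfl⟩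

end Involution

/-! ### Fundamental vector fields -/

section Action

variable {n : ℕ} {M : Type*} [MulAction (Fin n → Circle) M]

/-- The orbit map of `p`, composed with the exponential map of the torus. -/
def orbitMap (p : M) (ξ : Fin n → ℝ) : M := torusExp ξ • p

theorem orbitMap_zero (p : M) : orbitMap p (0 : Fin n → ℝ) = p := by
  rw [orbitMap, torusExp_zero, one_smul]

theorem orbitMap_add (p : M) (ξ η : Fin n → ℝ) :
    orbitMap p (ξ + η) = torusExp ξ • orbitMap p η := by
  rw [orbitMap, torusExp_add, mul_smul, orbitMap]

variable [TopologicalSpace M] [ChartedSpace (EuclideanSpace ℝ (Fin (2 * n))) M]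

/-- Smoothness of the torus action. -/
def IsSmoothAction (n : ℕ) (M : Type*) [TopologicalSpace M]
    [ChartedSpace (EuclideanSpace ℝ (Fin (2 * n))) M] [MulAction (Fin n → Circle) M] : Prop :=
  ContMDiff (𝓘(ℝ, Fin n → ℝ).prod (𝓡 (2 * n))) (𝓡 (2 * n)) ∞
    (fun q : (Fin n → ℝ) × M => torusExp q.1 • q.2)

namespace IsSmoothAction

theorem contMDiff_orbitMap (h : IsSmoothAction n M) (p : M) :
    ContMDiff 𝓘(ℝ, Fin n → ℝ) (𝓡 (2 * n)) ∞ (orbitMap (n := n) p) :=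
  ContMDiff.comp h (contMDiff_id.prodMk contMDiff_const)

theorem contMDiff_smul (h : IsSmoothAction n M) (t : Fin n → Circle) :
    ContMDiff (𝓡 (2 * n)) (𝓡 (2 * n)) ∞ (fun q : M => t • q) := by
  obtain ⟨ξ, rfl⟩ := surjective_torusExp t
  exact ContMDiff.comp (f := fun q : M => (ξ, q)) h (contMDiff_const.prodMk contMDiff_id)

theorem continuous_smul_const (h : IsSmoothAction n M) (p : M) :
    Continuous fun t : Fin n → Circle => t • p :=
  isOpenQuotientMap_torusExp.isQuotientMap.continuous_iff.2 (h.contMDiff_orbitMap p).continuous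

theorem hasMFDerivAt_curve (h : IsSmoothAction n M) (p : M) (ξ : Fin n → ℝ) (s : ℝ) :
    HasMFDerivAt 𝓘(ℝ, ℝ) (𝓡 (2 * n)) (fun s : ℝ => orbitMap p (s • ξ)) s
      ((mfderiv 𝓘(ℝ, Fin n → ℝ) (𝓡 (2 * n)) (orbitMap (n := n) p) (s • ξ)).comp
        ((1 : ℝ →L[ℝ] ℝ).smulRight ξ)) := by
  have h1 : HasMFDerivAt 𝓘(ℝ, ℝ) 𝓘(ℝ, Fin n → ℝ) (fun s : ℝ => s • ξ) s
      ((1 : ℝ →L[ℝ] ℝ).smulRight ξ) :=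
    (((1 : ℝ →L[ℝ] ℝ).smulRight ξ).hasFDerivAt (x := s)).hasMFDerivAt
  exact HasMFDerivAt.comp s
    ((h.contMDiff_orbitMap p (s • ξ)).mdifferentiableAt (by simp)).hasMFDerivAt h1

/-- The fundamental vector field as a linear function of the element of the Lie algebra. -/
theorem fundField_eq (h : IsSmoothAction n M) (p : M) (ξ : Fin n → ℝ) :
    (fundField ξ p : EuclideanSpace ℝ (Fin (2 * n))) =
      (mfderiv 𝓘(ℝ, Fin n → ℝ) (𝓡 (2 * n)) (orbitMap (n := n) p) 0 :
        (Fin n → ℝ) →L[ℝ] EuclideanSpace ℝ (Fin (2 * n))) ξ := by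
  have h1 := (h.hasMFDerivAt_curve p ξ 0).mfderiv
  unfold fundField
  change (mfderiv 𝓘(ℝ, ℝ) (𝓡 (2 * n)) (fun s : ℝ => orbitMap p (s • ξ)) 0 :
    ℝ →L[ℝ] EuclideanSpace ℝ (Fin (2 * n))) (1 : ℝ) = _
  rw [h1, zero_smul]
  change (mfderiv 𝓘(ℝ, Fin n → ℝ) (𝓡 (2 * n)) (orbitMap (n := n) p) 0 :
    (Fin n → ℝ) →L[ℝ] EuclideanSpace ℝ (Fin (2 * n))) ((1 : ℝ) • ξ) = _
  rw [one_smul]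

theorem fundField_sum (h : IsSmoothAction n M) (p : M) {ι : Type*} (s : Finset ι)
    (c : ι → ℝ) (ξ : ι → Fin n → ℝ) :
    fundField (∑ i ∈ s, c i • ξ i) p = ∑ i ∈ s, c i • fundField (ξ i) p := by
  have e (ξ : Fin n → ℝ) : fundField ξ p = _ := h.fundField_eq p ξ
  simp only [e]
  have hL (L : (Fin n → ℝ) →L[ℝ] EuclideanSpace ℝ (Fin (2 * n))) :
      L (∑ i ∈ s, c i • ξ i) = ∑ i ∈ s, c i • L (ξ i) := by
    simp only [map_sum, map_smul]
  exact hL _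

variable [IsManifold (𝓡 (2 * n)) ∞ M]

/-- The fundamental vector fields are continuous. -/
theorem continuous_fundField (h : IsSmoothAction n M) (ξ : Fin n → ℝ) :
    Continuous (fun p : M => (⟨p, fundField ξ p⟩ : TangentBundle (𝓡 (2 * n)) M)) := by
  have : IsManifold (𝓡 (2 * n)) 1 M := IsManifold.of_le (n := ∞) (by simp)
  have h1 : Continuous (tangentMap (𝓘(ℝ, Fin n → ℝ).prod (𝓡 (2 * n))) (𝓡 (2 * n))
      (fun q : (Fin n → ℝ) × M => torusExp q.1 • q.2)) :=
    ContMDiff.continuous_tangentMap h (by simp)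
  have h2 : Continuous (fun p : M => (⟨p, 0⟩ : TangentBundle (𝓡 (2 * n)) M)) :=
    (Bundle.contMDiff_zeroSection (n := 1) (IB := 𝓡 (2 * n)) ℝ
      (TangentSpace (𝓡 (2 * n)) : M → Type _)).continuous
  -- The fundamental field at `p` is the tangent map of the action applied to `ξ` at `0` and the
  -- zero vector at `p`.
  have h3 : Continuous fun p : M => (equivTangentBundleProd 𝓘(ℝ, Fin n → ℝ) (Fin n → ℝ)
      (𝓡 (2 * n)) M).symm ((⟨0, ξ⟩ : TangentBundle 𝓘(ℝ, Fin n → ℝ) (Fin n → ℝ)), ⟨p, 0⟩) :=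
    (contMDiff_equivTangentBundleProd_symm (n := 0)).continuous.comp (continuous_const.prodMk h2)
  convert h1.comp h3 using 1
  funext p
  have hmd : MDifferentiableAt (𝓘(ℝ, Fin n → ℝ).prod (𝓡 (2 * n))) (𝓡 (2 * n))
      (fun q : (Fin n → ℝ) × M => torusExp q.1 • q.2) (0, p) :=
    (ContMDiff.mdifferentiable h (by simp)) (0, p)
  have hl : HasMFDerivAt 𝓘(ℝ, Fin n → ℝ) (𝓘(ℝ, Fin n → ℝ).prod (𝓡 (2 * n)))
      (fun η : Fin n → ℝ => (η, p)) 0 (ContinuousLinearMap.inl ℝ (Fin n → ℝ) _) :=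
    (hasMFDerivAt_id (I := 𝓘(ℝ, Fin n → ℝ)) (0 : Fin n → ℝ)).prodMk
      (hasMFDerivAt_const (I := 𝓘(ℝ, Fin n → ℝ)) (I' := 𝓡 (2 * n)) p (0 : Fin n → ℝ))
  have hc := (HasMFDerivAt.comp (0 : Fin n → ℝ) hmd.hasMFDerivAt hl).mfderiv
  have he := h.fundField_eq p ξ
  refine Bundle.TotalSpace.ext (orbitMap_zero p).symm (heq_of_eq ?_)
  refine he.trans ?_
  exact congrArg (fun L : (Fin n → ℝ) →L[ℝ] EuclideanSpace ℝ (Fin (2 * n)) => L ξ) hc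

/-- A point at which a fundamental vector field vanishes is fixed by its one-parameter subgroup. -/
theorem torusExp_smul_eq_of_fundField_eq_zero (h : IsSmoothAction n M) [T2Space M] {p : M}
    {ξ : Fin n → ℝ}
    (hξ : fundField ξ p = 0) (s : ℝ) : torusExp (s • ξ) • p = p := by
  have : IsManifold (𝓡 (2 * n)) 1 M := IsManifold.of_le (n := ∞) (by simp)
  have h0 : HasMFDerivAt 𝓘(ℝ, ℝ) (𝓡 (2 * n)) (fun s : ℝ => orbitMap p (s • ξ)) 0
      (0 : ℝ →L[ℝ] EuclideanSpace ℝ (Fin (2 * n))) := by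
    have h1 := h.hasMFDerivAt_curve p ξ 0
    have h3 : (mfderiv 𝓘(ℝ, ℝ) (𝓡 (2 * n)) (fun s : ℝ => orbitMap p (s • ξ)) 0 :
        ℝ →L[ℝ] EuclideanSpace ℝ (Fin (2 * n))) = 0 :=
      ContinuousLinearMap.ext_ring (hξ : _ = (0 : EuclideanSpace ℝ (Fin (2 * n))))
    exact h3 ▸ h1.mdifferentiableAt.hasMFDerivAt
  -- By the group law the velocity at time `s` is the image of the velocity at time 0 under the
  -- differential of `exp (s ξ)`, so it vanishes for all `s`. Uniqueness of integral curves of the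
  -- zero field then makes the curve constant.
  have hcurve : IsMIntegralCurve (I := 𝓡 (2 * n)) (fun s : ℝ => orbitMap p (s • ξ))
      (fun _ : M => 0) := by
    intro s
    have h1 : HasMFDerivAt 𝓘(ℝ, ℝ) 𝓘(ℝ, ℝ) (fun r : ℝ => r - s) s
        (ContinuousLinearMap.id ℝ ℝ) :=
      ((hasFDerivAt_id s).sub_const s).hasMFDerivAt
    have h2 : HasMFDerivAt 𝓘(ℝ, ℝ) (𝓡 (2 * n)) (fun s : ℝ => orbitMap p (s • ξ)) (s - s)
      (0 : ℝ →L[ℝ] EuclideanSpace ℝ (Fin (2 * n))) := by rw [sub_self]; exact h0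
    have h3 := ((h.contMDiff_smul (torusExp (s • ξ))).mdifferentiable (by simp)
      (orbitMap p ((s - s) • ξ))).hasMFDerivAt
    have h4 := HasMFDerivAt.comp s h3 (HasMFDerivAt.comp (f := fun r : ℝ => r - s) s h2 h1)
    have h5 : (fun q : M => torusExp (s • ξ) • q) ∘
        (fun s : ℝ => orbitMap p (s • ξ)) ∘ (fun r : ℝ => r - s) =
        fun r : ℝ => orbitMap p (r • ξ) := by
      funext r
      simp only [Function.comp_apply, ← orbitMap_add, ← add_smul, add_sub_cancel]
    rw [h5] at h4
    have h6 (A : EuclideanSpace ℝ (Fin (2 * n)) →L[ℝ] EuclideanSpace ℝ (Fin (2 * n))) :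
        A.comp ((0 : ℝ →L[ℝ] EuclideanSpace ℝ (Fin (2 * n))).comp (ContinuousLinearMap.id ℝ ℝ)) =
          (1 : ℝ →L[ℝ] ℝ).smulRight 0 := by
      ext
      simp
    exact h4.congr_mfderiv (h6 _)
  have hconst : IsMIntegralCurve (I := 𝓡 (2 * n)) (fun _ : ℝ => p) (fun _ : M => 0) :=
    isMIntegralCurve_const rfl
  have heq := isMIntegralCurve_Ioo_eq_of_contMDiff_boundaryless (t₀ := 0)
    ((Bundle.contMDiff_zeroSection (n := 1) (IB := 𝓡 (2 * n)) ℝ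
      (TangentSpace (𝓡 (2 * n)) : M → Type _))) hcurve hconst
    (by simp only [zero_smul, orbitMap_zero])
  exact congrFun heq s

end IsSmoothAction

end Action

/-! ### Density of the preimage of the interior of the moment polytope -/

/-- A finite union of closed sets with empty interior has empty interior. -/
theorem interior_biUnion_eq_empty {X ι : Type*} [TopologicalSpace X] {s : Set ι} (hs : s.Finite)
    {A : ι → Set X} (hA : ∀ i ∈ s, IsClosed (A i)) (hA' : ∀ i ∈ s, interior (A i) = ∅) :
    interior (⋃ i ∈ s, A i) = ∅ := by
  induction s, hs using Set.Finite.induction_on with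
  | empty => simp
  | @insert a s _ _ ih =>
    rw [Set.biUnion_insert, interior_union_isClosed_of_interior_empty (hA a (Set.mem_insert _ _))
      (ih (fun i hi => hA i (Set.mem_insert_of_mem _ hi))
        fun i hi => hA' i (Set.mem_insert_of_mem _ hi))]
    exact hA' a (Set.mem_insert _ _)

section Density

variable {n : ℕ} {M : Type*} [TopologicalSpace M] [ChartedSpace (EuclideanSpace ℝ (Fin (2 * n))) M]
  [IsManifold (𝓡 (2 * n)) ∞ M] [MulAction (Fin n → Circle) M]

/-- In an effective torus action, the points with discrete stabilizer are dense. -/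
theorem IsSmoothAction.interior_exists_fundField_eq_zero [T2Space M]
    [PreconnectedSpace M] [FaithfulSMul (Fin n → Circle) M] (h : IsSmoothAction n M) :
    interior {p : M | ∃ ξ : Fin n → ℝ, ξ ≠ 0 ∧ fundField ξ p = 0} = ∅ := by
  -- The stabilizer of such a point is closed and contains a nontrivial one-parameter subgroup.
  have hfix : {p : M | ∃ ξ : Fin n → ℝ, ξ ≠ 0 ∧ fundField ξ p = 0} ⊆
      ⋃ t ∈ torsionTwo n, {p : M | t • p = p} := by
    rintro p ⟨ξ, hξ, hp⟩
    obtain ⟨t, ht, htp⟩ := exists_torsionTwo_mem (H := {t | t • p = p})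
      (isClosed_eq (h.continuous_smul_const p) continuous_const) hξ
      (h.torusExp_smul_eq_of_fundField_eq_zero hp)
    exact Set.mem_biUnion ht htp
  refine Set.subset_empty_iff.1 ((interior_mono hfix).trans ?_)
  rw [interior_biUnion_eq_empty (finite_torsionTwo n)]
  · exact fun t _ => isClosed_eq (h.contMDiff_smul t).continuous continuous_id
  · intro t ht
    by_contra hne
    refine ht.1 (eq_of_smul_eq_smul (α := M) fun p => ?_)
    rw [one_smul]
    refine eq_self_of_involutive (σ := fun q : M => t • q)
      ((h.contMDiff_smul t).of_le (by simp)) (fun q => ?_) (Set.nonempty_iff_ne_empty.2 hne) p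
    rw [← mul_smul, ht.2, one_smul]

variable {e : Module.Basis (Fin n) ℝ (Fin n → ℝ)} (S : ToricSymplectic n M e)

theorem ToricSymplectic.isSmoothAction {e : Module.Basis (Fin n) ℝ (Fin n → ℝ)}
    (S : ToricSymplectic n M e) : IsSmoothAction n M := S.smooth_action

theorem ToricSymplectic.dirDeriv_μ (p : M) (v : TangentSpace (𝓡 (2 * n)) p) (j : Fin n) :
    dirDeriv (fun q => S.μ q j) p v =
      (mfderiv (𝓡 (2 * n)) 𝓘(ℝ, Fin n → ℝ) S.μ p : _ →L[ℝ] (Fin n → ℝ)) v j := by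
  have h1 := (S.smooth_μ.mdifferentiable (by simp) p).hasMFDerivAt
  have h2 : HasMFDerivAt 𝓘(ℝ, Fin n → ℝ) 𝓘(ℝ, ℝ) (fun x : Fin n → ℝ => x j) (S.μ p)
      (ContinuousLinearMap.proj (R := ℝ) (φ := fun _ : Fin n => ℝ) j) :=
    (hasFDerivAt_apply j (S.μ p)).hasMFDerivAt
  have h3 := (HasMFDerivAt.comp p h2 h1).mfderiv
  exact congrArg (fun L : EuclideanSpace ℝ (Fin (2 * n)) →L[ℝ] ℝ => L v) h3

/-- Points with linearly independent fundamental vector fields are regular for the moment map. -/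
theorem ToricSymplectic.mem_openPart {p : M}
    (hp : ∀ ξ : Fin n → ℝ, ξ ≠ 0 → fundField ξ p ≠ 0) : p ∈ S.openPart := by
  refine mem_interior_range_of_surjective_mfderiv ((S.smooth_μ p).of_le (by simp)) ?_
  set L : EuclideanSpace ℝ (Fin (2 * n)) →L[ℝ] (Fin n → ℝ) :=
    mfderiv (𝓡 (2 * n)) 𝓘(ℝ, Fin n → ℝ) S.μ p with hL
  change Function.Surjective L
  by_contra hns
  have hlt : LinearMap.range (L : EuclideanSpace ℝ (Fin (2 * n)) →ₗ[ℝ] (Fin n → ℝ)) < ⊤ :=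
    lt_top_iff_ne_top.2 fun h => hns (LinearMap.range_eq_top.1 h)
  -- A nonzero functional `f` that kills the image of `dμ` has coefficients `c`. Then `ξ = ∑ c_j
  -- e_j` is nonzero and its fundamental field pairs to `-f (dμ v) = 0` with every `v`, so it
  -- vanishes by nondegeneracy.
  obtain ⟨f, hf, hker⟩ := Submodule.exists_le_ker_of_lt_top _ hlt
  set c : Fin n → ℝ := fun j => f (Pi.single j 1) with hc
  have hfc (x : Fin n → ℝ) : f x = ∑ j, c j * x j := by
    conv_lhs => rw [← Finset.univ_sum_single x, map_sum]
    refine Finset.sum_congr rfl fun j _ => ?_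
    rw [hc, mul_comm, ← smul_eq_mul, ← map_smul, ← Pi.single_smul', smul_eq_mul, mul_one]
  have hc0 : c ≠ 0 := by
    intro h0
    apply hf
    ext x
    simp [hc ▸ congrFun h0 x]
  have hξ : ∑ j, c j • e j ≠ 0 := by
    intro h0
    exact hc0 (funext (Fintype.linearIndependent_iff.1 e.linearIndependent c h0))
  apply hp _ hξ
  apply S.nondegenerate p
  intro v
  have h1 : f (L v) = 0 := hker ⟨v, rfl⟩
  rw [S.isSmoothAction.fundField_sum, map_sum, sum_apply]
  simp only [map_smul, smul_apply, S.hamiltonian, S.dirDeriv_μ]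
  rw [hfc] at h1
  simp only [smul_eq_mul, mul_neg, Finset.sum_neg_distrib]
  exact neg_eq_zero.2 h1

theorem ToricSymplectic.dense_openPart [T2Space M] [PreconnectedSpace M]
    [FaithfulSMul (Fin n → Circle) M] : Dense S.openPart := by
  refine (interior_eq_empty_iff_dense_compl.1
    S.isSmoothAction.interior_exists_fundField_eq_zero).mono fun p hp => S.mem_openPart ?_
  exact fun ξ hξ h0 => hp ⟨ξ, hξ, h0⟩

end Density

/-! ### The Gram matrix of the fundamental vector fields -/

section Gram

variable {n : ℕ} {M : Type*} [TopologicalSpace M] [ChartedSpace (EuclideanSpace ℝ (Fin (2 * n))) M]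
  [IsManifold (𝓡 (2 * n)) ∞ M] [MulAction (Fin n → Circle) M]
  {e : Module.Basis (Fin n) ℝ (Fin n → ℝ)}

namespace ToricSymplectic

/-- The Gram matrix `Ω (X_k, I X_l)` of the fundamental vector fields. -/
def gram (S : ToricSymplectic n M e)
    (I : ∀ p : M, TangentSpace (𝓡 (2 * n)) p →L[ℝ] TangentSpace (𝓡 (2 * n)) p) (p : M) :
    Matrix (Fin n) (Fin n) ℝ :=
  Matrix.of fun k l => S.Ω p (fundField (e k) p) (I p (fundField (e l) p))

variable (S : ToricSymplectic n M e)
  {I : ∀ p : M, TangentSpace (𝓡 (2 * n)) p →L[ℝ] TangentSpace (𝓡 (2 * n)) p}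

theorem Ω_swap (p : M) (v w : TangentSpace (𝓡 (2 * n)) p) : S.Ω p v w = -S.Ω p w v := by
  have h := S.alternating p (v + w)
  simp only [map_add, add_apply, S.alternating] at h
  linarith

/-- Continuity on all of `M`, and not only on `M°`, is what provides the limits of `φ_s⁻¹` over the
boundary of `Δ`. -/
theorem continuous_gram (hI : S.IsToricKahler I) : Continuous (S.gram I) := by
  refine continuous_matrix fun k l => ?_
  have hX (j : Fin n) := S.isSmoothAction.continuous_fundField (e j)
  have hIX : Continuous fun p : M =>
      (⟨p, I p (fundField (e l) p)⟩ : TangentBundle (𝓡 (2 * n)) M) :=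
    Continuous.clm_bundle_apply hI.smooth.continuous (hX l)
  have h : Continuous fun p : M => Bundle.TotalSpace.mk' ℝ (E := Bundle.Trivial M ℝ) p
      (S.Ω p (fundField (e k) p) (I p (fundField (e l) p))) :=
    Continuous.clm_bundle_apply₂ S.smooth_Ω.continuous (hX k) hIX
  exact (Bundle.Trivial.homeomorphProd M ℝ).continuous.comp h |>.snd

/-- Symmetry comes from `I`-invariance of `Ω`. The quadratic form at `x` is `Ω (X, I X)` with `X = ∑
x_k X_k`; it is only semidefinite because `X` may vanish over the boundary of `Δ`. -/
theorem posSemidef_gram (hI : S.IsToricKahler I) (p : M) : (S.gram I p).PosSemidef := by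
  refine Matrix.PosSemidef.of_dotProduct_mulVec_nonneg ?_ fun x => ?_
  · ext k l
    simp only [gram, Matrix.conjTranspose_apply, Matrix.of_apply, star_trivial]
    rw [← hI.compatible, hI.sq_eq_neg, map_neg, S.Ω_swap, neg_neg]
  · have h : star x ⬝ᵥ (S.gram I p *ᵥ x) = S.Ω p (∑ k, x k • fundField (e k) p)
        (I p (∑ k, x k • fundField (e k) p)) := by
      simp only [gram, dotProduct, Matrix.mulVec, star_trivial, Matrix.of_apply, map_sum, map_smul,
        sum_apply, smul_apply, smul_eq_mul]
      simp only [Finset.mul_sum]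
      rw [Finset.sum_comm]
      refine Finset.sum_congr rfl fun k _ => Finset.sum_congr rfl fun l _ => by ring
    rw [h]
    rcases eq_or_ne (∑ k, x k • fundField (e k) p) 0 with h0 | h0
    · rw [h0, map_zero, map_zero, zero_apply]
    · exact (hI.positive p _ h0).le

variable {τ : (Fin n → ℝ) → ℝ}

/-- Since `dμ_k (I X_l) = -Ω (X_k, I X_l)`, the duality `ϑ_j (I X_l) = δ_jl` is this matrix
identity. -/
theorem hessian_mul_gram (hτ : S.IsSymplecticPotential I τ) {p : M} (hp : p ∈ S.openPart) :
    hessian τ (S.μ p) * S.gram I p = 1 := by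
  ext j l
  rw [Matrix.mul_apply, Matrix.one_apply, ← hτ.coframe_rot p hp j l, ← Finset.sum_neg_distrib]
  refine Finset.sum_congr rfl fun k _ => ?_
  rw [← mul_neg, ← S.hamiltonian]
  rfl

theorem admissible_eq : S.admissible τ = admissibleFor (Set.range (S.hessInvSqrt τ)) := by
  ext F
  simp [admissible, admissibleFor]

variable [T2Space M] [PreconnectedSpace M] [FaithfulSMul (Fin n → Circle) M]

/-- The continuous extension of the inverse Hessian of a symplectic potential is the Gram matrix of
the fundamental vector fields. -/
theorem hessInv_eq_gram (hI : S.IsToricKahler I) (hτ : S.IsSymplecticPotential I τ) :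
    S.hessInv τ = S.gram I := by
  funext p
  -- Density of `M°` makes the limit at `p` unique, so it suffices that the Gram matrix is a limit
  -- of the inverse Hessians.
  refine extendFrom_eq (S.dense_openPart p) ?_
  refine ((S.continuous_gram hI).continuousWithinAt (s := S.openPart) (x := p)).tendsto.congr' ?_
  filter_upwards [self_mem_nhdsWithin] with q hq
  exact (Matrix.inv_eq_right_inv (S.hessian_mul_gram hτ hq)).symm

/-- The square roots of the values of the inverse Hessian form a compact set. -/
theorem range_hessInvSqrt (hI : S.IsToricKahler I) (hτ : S.IsSymplecticPotential I τ) :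
    Set.range (S.hessInvSqrt τ) =
      {A : Matrix (Fin n) (Fin n) ℝ | A.PosSemidef ∧ A * A ∈ Set.range (S.gram I)} := by
  have h := S.hessInv_eq_gram hI hτ
  ext A
  constructor
  · rintro ⟨p, rfl⟩
    refine ⟨Matrix.nonneg_iff_posSemidef.1 (CFC.sqrt_nonneg _), p, ?_⟩
    rw [hessInvSqrt, h, CFC.sqrt_mul_sqrt_self _ (S.posSemidef_gram hI p).nonneg]
  · rintro ⟨hA, p, hp⟩
    refine ⟨p, ?_⟩
    rw [hessInvSqrt, h]
    exact CFC.sqrt_unique hp.symm hA.nonneg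

end ToricSymplectic

end Gram

end ToricKahler

end
-- The admissible set of a symplectic potential
theorem proposition6p1 (n : ℕ) (M : Type*) [TopologicalSpace M] [T2Space M] [CompactSpace M]
    [ConnectedSpace M] [ChartedSpace (EuclideanSpace ℝ (Fin (2 * n))) M]
    [IsManifold (𝓡 (2 * n)) ∞ M] [MulAction (Fin n → Circle) M] [FaithfulSMul (Fin n → Circle) M]
    (e : Module.Basis (Fin n) ℝ (Fin n → ℝ)) (S : ToricKahler.ToricSymplectic n M e)
    (I : ∀ p : M, TangentSpace (𝓡 (2 * n)) p →L[ℝ] TangentSpace (𝓡 (2 * n)) p)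
    (hI : S.IsToricKahler I) (τ : (Fin n → ℝ) → ℝ) (hτ : S.IsSymplecticPotential I τ) :
    Bornology.IsBounded (S.admissible τ) ∧ IsOpen (S.admissible τ) ∧
      Convex ℝ (S.admissible τ) ∧ 0 ∈ S.admissible τ ∧ StarConvex ℝ 0 (S.admissible τ) := by
  have hrange := S.range_hessInvSqrt hI hτ
  have hsymm : ∀ A ∈ Set.range (S.hessInvSqrt τ), Aᵀ = A := by
    rw [hrange]
    exact fun A hA => hA.1.1
  have hcompact : IsCompact (Set.range (S.hessInvSqrt τ)) := by
    rw [hrange]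
    exact ToricKahler.isCompact_sqrt (isCompact_range (S.continuous_gram hI))
  -- Over `M°` the Gram matrix inverts the Hessian, so its square root is the invertible `S` that
  -- boundedness requires.
  obtain ⟨p, hp⟩ := S.dense_openPart.nonempty
  have hunit : IsUnit (S.hessInvSqrt τ p) := by
    rw [ToricKahler.ToricSymplectic.hessInvSqrt, S.hessInv_eq_gram hI hτ,
      CFC.isUnit_sqrt_iff _ (S.posSemidef_gram hI p).nonneg]
    exact (Matrix.isUnit_iff_isUnit_det _).2
      (Matrix.isUnit_det_of_left_inverse (S.hessian_mul_gram hτ hp))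
  rw [S.admissible_eq]
  have hconvex := ToricKahler.convex_admissibleFor hsymm
  exact ⟨ToricKahler.isBounded_admissibleFor hsymm ⟨p, rfl⟩ hunit,
    ToricKahler.isOpen_admissibleFor hsymm hcompact, hconvex, ToricKahler.zero_mem_admissibleFor,
    hconvex.starConvex ToricKahler.zero_mem_admissibleFor⟩
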